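/- Let $M$ be a finite-dimensional smooth manifold (Hausdorff, without boundary), let $T^*M$ be its cotangent bundle with projection $\pi : T^*M \to M$, and let $\Theta$ be the tautological one-form on $T^*M$, $\langle \Theta(q,p), w\rangle = \langle p, T\pi\, w\rangle$ for $w \in T_{(q,p)}T^*M$. For a smooth vector field $v$ on $M$ with (local) flow $\Phi_\epsilon$, the cotangent lift $\widehat{v}$ is the vector field on $T^*M$ that generates the cotangent lifted flow, $$\widehat{v}(z) = \frac{d}{d\epsilon}\Big|_{\epsilon=0} (\Phi_{-\epsilon})^*(z), \qquad (\Phi_{-\epsilon})^*(q,p) = \big(\Phi_\epsilon(q),\; p\circ T_{\Phi_\epsilon(q)}\Phi_{-\epsilon}\big).$$ Let $f$ and $g$ be smooth vector fields on $M$ such that $g$ is a symmetry of the ODE $\dot q = f(q)$, i.e. $[g,f] = 0$. Then $\widehat{g}$ is a symmetry of the adjoint system $\dot z = \widehat{f}(z)$ on $T^*M$, i.e. $\widehat{g}$ is a smooth vector field on $T^*M$ with $[\widehat{g},\widehat{f}] = 0$. Moreover, the function $z \mapsto \langle \Theta(z), \widehat{g}(z)\rangle$ on $T^*M$ is preserved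 along the flow of $\widehat{f}$: it is constant along every integral curve $\gamma : J \to T^*M$ of $\widehat{f}$, where $J\subseteq\mathbb{R}$ is an interval. -/

import Mathlib

open Bundle Set
open scoped Manifold ContDiff Topology

noncomputable section

namespace AdjointSystem

variable {E : Type*} [NormedAddCommGroup E] [NormedSpace ℝ E]
  {H : Type*} [TopologicalSpace H] (I : ModelWithCorners ℝ E H)
  {M : Type*} [TopologicalSpace M] [ChartedSpace H M]

/-- The cotangent space `T*_q M`. -/
abbrev CotangentSpace (q : M) : Type _ := TangentSpace I q →L[ℝ] ℝ

/-- The cotangent bundle `T*M`: its points are the pairs `z = ⟨q, p⟩` with `p ∈ T*_q M`. Its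
topology and its atlas are those of Mathlib's bundle of continuous linear maps. -/
abbrev CotangentBundle (M : Type*) [TopologicalSpace M] [ChartedSpace H M]
    [IsManifold I 1 M] : Type _ :=
  TotalSpace (E →L[ℝ] ℝ) (fun q : M ↦ TangentSpace I q →L[ℝ] ℝ)

/-- The model with corners over which `T*M` is a manifold. -/
abbrev cotangentModel : ModelWithCorners ℝ (E × (E →L[ℝ] ℝ)) (ModelProd H (E →L[ℝ] ℝ)) :=
  I.prod 𝓘(ℝ, E →L[ℝ] ℝ)

open Classical in
/-- The (maximal local) flow `Φ_t` of a vector field `v`: `flow I v t x` is the value at time `t` of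
an integral curve of `v` that is defined on an open interval containing `0` and `t` and starts
at `x` at time `0`. If there is none, i.e. if `(t, x)` lies outside the flow domain, it has the
junk value `x`. -/
def flow (v : (x : M) → TangentSpace I x) (t : ℝ) (x : M) : M :=
  if h : ∃ γ : ℝ → M, γ 0 = x ∧
      ∃ a b : ℝ, 0 ∈ Ioo a b ∧ t ∈ Ioo a b ∧ IsMIntegralCurveOn γ v (Ioo a b)
  then h.choose t
  else x

theorem flow_zero (v : (x : M) → TangentSpace I x) (x : M) : flow I v 0 x = x := by
  unfold flow
  split_ifs with h
  · exact h.choose_spec.1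
  · rfl

/-- The pullback `φ^* : T*_{φ y} M → T*_y M` of covectors, `⟨φ^* α, w⟩ = ⟨α, T_y φ w⟩`. -/
def pullbackCovector (φ : M → M) (y : M) (α : CotangentSpace I (φ y)) : CotangentSpace I y :=
  α.comp (mfderiv I I φ y)

variable [IsManifold I 1 M]

/-- The cotangent lifted flow `(Φ_{-t})^* : T*M → T*M`, covering `Φ_t`: it sends `⟨q, p⟩` to
`⟨Φ_t q, p ∘ T_{Φ_t q} Φ_{-t}⟩`. The covector `p ∈ T*_q M` is read in the space `T*_{Φ_{-t} (Φ_t q)} M`,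
where `Φ_{-t} (Φ_t q) = q` whenever `(t, q)` is in the flow domain. -/
def cotangentFlow (v : (x : M) → TangentSpace I x) (t : ℝ) (z : CotangentBundle I M) :
    CotangentBundle I M :=
  ⟨flow I v t z.1,
    pullbackCovector I (flow I v (-t)) (flow I v t z.1) (show E →L[ℝ] ℝ from z.2)⟩

theorem cotangentFlow_zero (v : (x : M) → TangentSpace I x) (z : CotangentBundle I M) :
    cotangentFlow I v 0 z = z := by
  have h0 : flow I v (-0 : ℝ) = id := by
    funext x
    rw [neg_zero, flow_zero]
    rfl
  obtain ⟨q, p⟩ := z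
  unfold cotangentFlow
  dsimp only
  rw [flow_zero I v q]
  congr 1
  unfold pullbackCovector
  rw [h0]
  ext w
  simp [mfderiv_id]

/-- The cotangent lift `v̂` of the vector field `v`, a vector field on `T*M`: the infinitesimal
generator `v̂(z) = d/dε|_{ε = 0} (Φ_{-ε})^* z` of the cotangent lifted flow. (At `ε = 0` the curve
is at `cotangentFlow I v 0 z = z`.) -/
def cotangentLift (v : (x : M) → TangentSpace I x) (z : CotangentBundle I M) :
    TangentSpace (cotangentModel I) z :=
  mfderiv 𝓘(ℝ, ℝ) (cotangentModel I) (fun ε : ℝ ↦ cotangentFlow I v ε z) 0 (1 : ℝ)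

/-- The tautological one-form `Θ` on `T*M`: `⟨Θ(q, p), w⟩ = ⟨p, Tπ w⟩`, where `π : T*M → M` is the
projection. -/
def tautologicalForm (z : CotangentBundle I M) :
    TangentSpace (cotangentModel I) z →L[ℝ] ℝ :=
  z.2.comp (mfderiv (cotangentModel I) I
    (TotalSpace.proj : CotangentBundle I M → M) z)

/-- The function `⟨Θ, G⟩` on `T*M`, for a vector field `G` on `T*M`. -/
def thetaPairing (G : (z : CotangentBundle I M) → TangentSpace (cotangentModel I) z)
    (z : CotangentBundle I M) : ℝ :=
  tautologicalForm I z (G z)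

end AdjointSystem

end

/-! In the chart of `T*M` induced by a chart of `M`, the lift of a field with representative `V` is
the Hamiltonian field `(V, -p ∘ DV)` of `⟨p, V(x)⟩`; this is `localRep_cotangentLift`. All three
conclusions then become computations on `E × E*`. Smoothness can be read off the formula. The
bracket of two such fields has components `[V, W]` and `-p ∘ D[V, W]`, so it vanishes when `[V, W]`
vanishes near the base point (`lieBracket_liftRep_eq_zero`). The form `Θ` evaluated on the lift of
`W` is `⟨p, W(x)⟩`, whose derivative along the lift of `V` is `⟨p, [V, W]⟩ = 0`
(`hasDerivWithinAt_pairing`).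

The analytic work lies in the coordinate formula, because the lift is defined by differentiating the
flow. This requires that `Φ_t` be differentiable in the initial point, that the derivative satisfy
the variational equation, and that `t ↦ DΦ_{-t}(Φ_t x₀)` have derivative `-DV(x₀)` at `0`;
`ContDiffAt.exists_local_flow` supplies these facts. -/

/-! ### Local flows in a Banach space and their spatial derivatives. -/

/-- A curve issuing from `0` whose velocity is bounded by `K ‖f‖ + ε` stays, for a short time,
within distance `2 δ ε` of `0`. -/
theorem norm_le_of_norm_deriv_le_add {E : Type*} [NormedAddCommGroup E] [NormedSpace ℝ E]
    {f f' : ℝ → E} {K ε δ : ℝ} (hK : 0 ≤ K) (hε : 0 ≤ ε) (hKδ : K * δ ≤ 1 / 2)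
    (hf : ∀ t ∈ Ioo (-δ) δ, HasDerivAt f (f' t) t)
    (hb : ∀ t ∈ Ioo (-δ) δ, ‖f' t‖ ≤ K * ‖f t‖ + ε) (h0 : f 0 = 0)
    {t : ℝ} (ht : t ∈ Ioo (-δ) δ) : ‖f t‖ ≤ 2 * δ * ε := by
  have hsub : Icc (-|t|) |t| ⊆ Ioo (-δ) δ := fun s hs ↦ by
    have := abs_lt.2 ht
    exact ⟨by linarith [hs.1], by linarith [hs.2]⟩
  have hcont : ContinuousOn (fun s ↦ ‖f s‖) (Icc (-|t|) |t|) := fun s hs ↦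
    (hf s (hsub hs)).continuousAt.norm.continuousWithinAt
  have hmem : t ∈ Icc (-|t|) |t| := ⟨neg_abs_le t, le_abs_self t⟩
  have h0mem : (0 : ℝ) ∈ Icc (-|t|) |t| := ⟨by simp, by simp⟩
  -- At a maximum point `m` of `‖f‖` the mean value inequality gives `‖f m‖ ≤ (K ‖f m‖ + ε) δ ≤ ‖f
  -- m‖ / 2 + δ ε`, and the first term is absorbed; this replaces Grönwall.
  obtain ⟨m, hm, hmax⟩ := isCompact_Icc.exists_isMaxOn ⟨t, hmem⟩ hcont
  have hmax' : ∀ s ∈ Icc (-|t|) |t|, ‖f s‖ ≤ ‖f m‖ := fun s hs ↦ hmax hs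
  have key := Convex.norm_image_sub_le_of_norm_hasDerivWithin_le (C := K * ‖f m‖ + ε)
    (fun s hs ↦ (hf s (hsub hs)).hasDerivWithinAt)
    (fun s hs ↦ (hb s (hsub hs)).trans (by gcongr; exact hmax' s hs)) (convex_Icc _ _) h0mem hm
  rw [h0, sub_zero, sub_zero, Real.norm_eq_abs] at key
  have hmδ : |m| ≤ δ := (abs_lt.2 (hsub hm)).le
  have h1 : (K * ‖f m‖ + ε) * |m| ≤ (K * ‖f m‖ + ε) * δ := by gcongr
  have h2 : K * δ * ‖f m‖ ≤ 1 / 2 * ‖f m‖ := by gcongr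
  have := hmax' t hmem
  nlinarith

/-- The local flow of a `C²` vector field `v`, together with its spatial derivative `A`, which
solves the variational equation. -/
theorem ContDiffAt.exists_local_flow {E : Type*} [NormedAddCommGroup E] [NormedSpace ℝ E]
    [CompleteSpace E] {v : E → E} {x₀ : E} (hv : ContDiffAt ℝ 2 v x₀) {W : Set E}
    (hW : W ∈ 𝓝 x₀) :
    ∃ (δ : ℝ) (U : Set E) (Ψ : ℝ → E → E) (A : ℝ → E → E →L[ℝ] E), 0 < δ ∧ U ∈ 𝓝 x₀ ∧
      (∀ x ∈ U, Ψ 0 x = x) ∧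
      (∀ t ∈ Ioo (-δ) δ, ∀ x ∈ U, HasDerivAt (Ψ · x) (v (Ψ t x)) t ∧ Ψ t x ∈ W ∧
        HasFDerivAt (Ψ t) (A t x) x) ∧
      (∀ᶠ t in 𝓝 0, Ψ t x₀ ∈ U ∧ Ψ (-t) (Ψ t x₀) = x₀) ∧
      HasDerivAt (fun t ↦ A (-t) (Ψ t x₀)) (-fderiv ℝ v x₀) 0 := by
  -- The ODE is solved jointly with its variational equation, from initial data `(x, id)`. The
  -- second component is the candidate for the spatial derivative. Since `v` is `C²`, the system is
  -- `C¹` and Picard–Lindelöf applies.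
  set V : E × (E →L[ℝ] E) → E × (E →L[ℝ] E) := fun p ↦ (v p.1, (fderiv ℝ v p.1).comp p.2) with hV
  set p₀ : E × (E →L[ℝ] E) := (x₀, ContinuousLinearMap.id ℝ E) with hp₀
  have hdv : ContDiffAt ℝ 1 (fderiv ℝ v) x₀ := hv.fderiv_right (by norm_num)
  have hVC : ContDiffAt ℝ 1 V p₀ := by
    refine ContDiffAt.prodMk ?_ ?_
    · exact (hv.of_le (by norm_num)).comp p₀ contDiffAt_fst
    · exact ContDiffAt.clm_comp (hdv.comp p₀ contDiffAt_fst) contDiffAt_snd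
  obtain ⟨τ, hτ, a, r, L, K, hr, hpl⟩ := IsPicardLindelof.of_contDiffAt_one hVC
  obtain ⟨α, hα, L', hL'⟩ :=
    (hpl 0).exists_forall_mem_closedBall_eq_hasDerivWithinAt_lipschitzOnWith
  simp only [zero_sub, zero_add] at hα hL'
  -- a ball on which everything is controlled
  obtain ⟨K₂, s₂, hs₂, hlip₂⟩ := hdv.exists_lipschitzOnWith
  obtain ⟨K₁, s₁, hs₁, hlip₁⟩ := (hv.of_le (by norm_num : (1 : WithTop ℕ∞) ≤ 2)).exists_lipschitzOnWith
  have hdiff : ∀ᶠ x in 𝓝 x₀, DifferentiableAt ℝ v x :=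
    (hv.eventually (by simp)).mono fun x hx ↦ hx.differentiableAt (by norm_num)
  have hbd : ∀ᶠ x in 𝓝 x₀, ‖fderiv ℝ v x‖ < ‖fderiv ℝ v x₀‖ + 1 :=
    hdv.continuousAt.norm.eventually (gt_mem_nhds (by linarith))
  obtain ⟨ρ, hρ, hball⟩ := Metric.mem_nhds_iff.1
    (Filter.inter_mem (Filter.inter_mem (Filter.inter_mem hs₂ hs₁) hW) (hdiff.and hbd))
  set B := Metric.ball x₀ ρ with hB
  set C := ‖fderiv ℝ v x₀‖ + 1 with hC
  have hC0 : 0 ≤ C := by positivity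
  -- joint continuity
  have hcont : ContinuousOn (Function.uncurry α) (Metric.closedBall p₀ r ×ˢ Icc (-τ) τ) :=
    continuousOn_prod_of_continuousOn_lipschitzOnWith _ L'
      (fun x hx ↦ HasDerivWithinAt.continuousOn (hα x hx).2) hL'
  have hcont₀ : ContinuousAt (Function.uncurry α) (p₀, 0) :=
    hcont.continuousAt (prod_mem_nhds (Metric.closedBall_mem_nhds _ (by exact_mod_cast hr))
      (Icc_mem_nhds (by linarith) hτ))
  have hα₀ : α p₀ 0 = p₀ := (hα p₀ (Metric.mem_closedBall_self (by positivity))).1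
  set β : ℝ × E → E × (E →L[ℝ] E) := fun q ↦ α (q.2, ContinuousLinearMap.id ℝ E) q.1 with hβ
  have hβc : ContinuousAt β (0, x₀) := by
    have h : ContinuousAt (fun q : ℝ × E ↦ ((q.2, ContinuousLinearMap.id ℝ E), q.1)) (0, x₀) := by
      fun_prop
    exact ContinuousAt.comp (g := Function.uncurry α) (f := fun q : ℝ × E ↦
      ((q.2, ContinuousLinearMap.id ℝ E), q.1)) (x := (0, x₀)) hcont₀ h
  have hβ₀ : β (0, x₀) = p₀ := hα₀
  have hev : ∀ᶠ q in 𝓝 ((0 : ℝ), x₀), (β q).1 ∈ B := by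
    have : ContinuousAt (fun q ↦ (β q).1) (0, x₀) := hβc.fst
    refine this.eventually_mem ?_
    rw [hβ₀]
    exact Metric.ball_mem_nhds _ hρ
  rw [nhds_prod_eq, Filter.eventually_prod_iff] at hev
  obtain ⟨pa, hpa, pb, hpb, hab⟩ := hev
  obtain ⟨δ₁, hδ₁, hδ₁'⟩ := Metric.eventually_nhds_iff.1 hpa
  -- `δ₁` keeps the orbits in `B`, `τ` is the Picard–Lindelöf time, and the last term gives `C * δ ≤
  -- 1 / 2` for `norm_le_of_norm_deriv_le_add`.
  set δ := min (min δ₁ τ) (1 / (2 * (C + 1))) with hδ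
  have hδ0 : 0 < δ := by positivity
  have hCδ : C * δ ≤ 1 / 2 := by
    have : C * δ ≤ (C + 1) * (1 / (2 * (C + 1))) := by
      gcongr
      · linarith
      · exact min_le_right _ _
    refine this.trans (le_of_eq ?_)
    field_simp
  set U := {x | pb x} ∩ Metric.ball x₀ r with hU
  have hUn : U ∈ 𝓝 x₀ := Filter.inter_mem hpb (Metric.ball_mem_nhds _ (by exact_mod_cast hr))
  obtain ⟨U', hU'U, hU'o, hxU'⟩ := mem_nhds_iff.1 hUn
  have hin : ∀ t ∈ Ioo (-δ) δ, ∀ x ∈ U, (β (t, x)).1 ∈ B := fun t ht x hx ↦ by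
    refine hab (hδ₁' ?_) hx.1
    rw [Real.dist_eq, sub_zero]
    exact (abs_lt.2 ht).trans_le ((min_le_left _ _).trans (min_le_left _ _))
  have htτ : ∀ t ∈ Ioo (-δ) δ, t ∈ Ioo (-τ) τ := fun t ht ↦ by
    have : δ ≤ τ := (min_le_left _ _).trans (min_le_right _ _)
    exact ⟨by linarith [ht.1], by linarith [ht.2]⟩
  have hxr : ∀ x ∈ U, ((x, ContinuousLinearMap.id ℝ E) : E × (E →L[ℝ] E)) ∈
      Metric.closedBall p₀ r := fun x hx ↦ by
    rw [Metric.mem_closedBall, Prod.dist_eq]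
    simpa [hp₀] using (Metric.mem_ball.1 hx.2).le
  have hβ0 : ∀ x ∈ U, β (0, x) = (x, ContinuousLinearMap.id ℝ E) := fun x hx ↦ (hα _ (hxr x hx)).1
  have hβd : ∀ t ∈ Ioo (-δ) δ, ∀ x ∈ U, HasDerivAt (fun s ↦ β (s, x)) (V (β (t, x))) t :=
    fun t ht x hx ↦ ((hα _ (hxr x hx)).2 t (Ioo_subset_Icc_self (htτ t ht))).hasDerivAt
      (Icc_mem_nhds (htτ t ht).1 (htτ t ht).2)
  have hΨd : ∀ t ∈ Ioo (-δ) δ, ∀ x ∈ U, HasDerivAt (fun s ↦ (β (s, x)).1) (v (β (t, x)).1) t :=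
    fun t ht x hx ↦ (hβd t ht x hx).fst
  have hAd : ∀ t ∈ Ioo (-δ) δ, ∀ x ∈ U, HasDerivAt (fun s ↦ (β (s, x)).2)
      ((fderiv ℝ v (β (t, x)).1).comp (β (t, x)).2) t :=
    fun t ht x hx ↦ (hβd t ht x hx).snd
  have hlipx : ∀ t ∈ Ioo (-δ) δ, ∀ x ∈ U, ∀ y ∈ U,
      ‖(β (t, y)).1 - (β (t, x)).1‖ ≤ L' * ‖y - x‖ := fun t ht x hx y hy ↦ by
    have h := (hL' t (Ioo_subset_Icc_self (htτ t ht))).norm_sub_le (hxr y hy) (hxr x hx)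
    refine (norm_fst_le (β (t, y) - β (t, x))).trans (h.trans (le_of_eq ?_))
    simp [Prod.norm_def]
  -- The Taylor remainder is quadratic because `fderiv ℝ v` is Lipschitz on `B`.
  have htaylor : ∀ y ∈ B, ∀ z ∈ B, ‖v z - v y - fderiv ℝ v y (z - y)‖ ≤ K₂ * ‖z - y‖ * ‖z - y‖ := by
    intro y hy z hz
    have hseg : segment ℝ y z ⊆ B := (convex_ball x₀ ρ).segment_subset hy hz
    refine (convex_segment y z).norm_image_sub_le_of_norm_hasFDerivWithin_le'
      (f' := fun w ↦ fderiv ℝ v w) (fun w hw ↦ ?_) (fun w hw ↦ ?_) (left_mem_segment ℝ y z)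
      (right_mem_segment ℝ y z)
    · exact (hball (hseg hw)).2.1.hasFDerivAt.hasFDerivWithinAt
    · refine (hlip₂.norm_sub_le (hball (hseg hw)).1.1.1 (hball hy).1.1.1).trans ?_
      gcongr
      exact norm_sub_le_of_mem_segment hw
  refine ⟨δ, U', fun t x ↦ (β (t, x)).1, fun t x ↦ (β (t, x)).2, hδ0, hU'o.mem_nhds hxU',
    fun x hx ↦ by simp [hβ0 x (hU'U hx)], fun t ht x hx ↦ ⟨hΨd t ht x (hU'U hx),
      (hball (hin t ht x (hU'U hx))).1.2, ?_⟩, ?_, ?_⟩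
  · -- differentiability in the initial point
    have hxU := hU'U hx
    -- The error of the candidate linearization solves the variational equation up to the Taylor
    -- remainder, which is `O(‖y - x‖²)` because the flow is Lipschitz in the initial point. It
    -- starts at `0`, so it stays of that order.
    have hbig : ∀ y ∈ U, ‖(β (t, y)).1 - (β (t, x)).1 - (β (t, x)).2 (y - x)‖ ≤
        2 * δ * (K₂ * L' ^ 2 * ‖y - x‖ ^ 2) := fun y hy ↦ by
      refine norm_le_of_norm_deriv_le_add
        (f := fun s ↦ (β (s, y)).1 - (β (s, x)).1 - (β (s, x)).2 (y - x)) hC0 (by positivity)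
        hCδ (fun s hs ↦ (((hΨd s hs y hy).sub (hΨd s hs x hxU)).sub
          ((hAd s hs x hxU).clm_apply (hasDerivAt_const s (y - x))))) (fun s hs ↦ ?_) ?_ ht
      · have e : v (β (s, y)).1 - v (β (s, x)).1 - (((fderiv ℝ v (β (s, x)).1).comp (β (s, x)).2)
            (y - x) + (β (s, x)).2 0) = fderiv ℝ v (β (s, x)).1
              ((β (s, y)).1 - (β (s, x)).1 - (β (s, x)).2 (y - x)) +
            (v (β (s, y)).1 - v (β (s, x)).1 -
              fderiv ℝ v (β (s, x)).1 ((β (s, y)).1 - (β (s, x)).1)) := by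
          simp only [map_sub, map_zero, ContinuousLinearMap.comp_apply]
          abel
        rw [e]
        refine (norm_add_le _ _).trans (add_le_add ?_ ?_)
        · refine (ContinuousLinearMap.le_opNorm _ _).trans ?_
          gcongr
          exact (hball (hin s hs x hxU)).2.2.le
        · refine (htaylor _ (hin s hs x hxU) _ (hin s hs y hy)).trans ?_
          have h := hlipx s hs x hxU y hy
          calc K₂ * ‖(β (s, y)).1 - (β (s, x)).1‖ * ‖(β (s, y)).1 - (β (s, x)).1‖
              ≤ K₂ * (L' * ‖y - x‖) * (L' * ‖y - x‖) := by gcongr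
            _ = K₂ * L' ^ 2 * ‖y - x‖ ^ 2 := by ring
      · simp [hβ0 x hxU, hβ0 y hy]
    have hO : (fun y ↦ (β (t, y)).1 - (β (t, x)).1 - (β (t, x)).2 (y - x)) =O[𝓝 x]
        fun y ↦ ‖y - x‖ ^ 2 := by
      refine Asymptotics.IsBigO.of_bound (2 * δ * (K₂ * L' ^ 2)) ?_
      filter_upwards [hU'o.mem_nhds hx] with y hy
      refine (hbig y (hU'U hy)).trans (le_of_eq ?_)
      rw [Real.norm_of_nonneg (by positivity)]
      ring
    have h1 := hO.hasFDerivAt (𝕜 := ℝ) (by norm_num : 1 < 2)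
    have h2 := (h1.add ((β (t, x)).2.hasFDerivAt.comp x
      ((hasFDerivAt_id (𝕜 := ℝ) x).sub_const x))).add_const ((β (t, x)).1)
    refine (h2.congr_fderiv ?_).congr_of_eventuallyEq (Filter.Eventually.of_forall fun y ↦ ?_)
    · ext; simp
    · simp
  · -- the backward flow inverts the forward flow
    have hc : ContinuousAt (fun t ↦ (β (t, x₀)).1) 0 :=
      (hΨd 0 ⟨by linarith, hδ0⟩ x₀ (hU'U hxU')).continuousAt
    have hc' : ∀ᶠ t in 𝓝 0, (β (t, x₀)).1 ∈ U' := by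
      refine hc.eventually_mem ?_
      rw [hβ₀]
      exact hU'o.mem_nhds hxU'
    filter_upwards [hc', Ioo_mem_nhds (by linarith : -(δ / 2) < 0) (by linarith : 0 < δ / 2)]
      with t ht ht'
    refine ⟨ht, ?_⟩
    have hsum : ∀ s ∈ Ioo (-(δ / 2)) (δ / 2), t + s ∈ Ioo (-δ) δ := fun s hs ↦
      ⟨by linarith [hs.1, ht'.1], by linarith [hs.2, ht'.2]⟩
    have hsδ : ∀ s ∈ Ioo (-(δ / 2)) (δ / 2), s ∈ Ioo (-δ) δ := fun s hs ↦
      ⟨by linarith [hs.1], by linarith [hs.2]⟩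
    -- The curves `s ↦ Ψ s (Ψ t x₀)` and `s ↦ Ψ (t + s) x₀` solve the same ODE; they are compared at
    -- `s = -t`. Halving `δ` keeps `t + s` in the time interval.
    have huniq := ODE_solution_unique_of_mem_Ioo (v := fun _ ↦ v) (s := fun _ ↦ B) (K := K₁)
      (f := fun s ↦ (β (s, (β (t, x₀)).1)).1) (g := fun s ↦ (β (t + s, x₀)).1) (t₀ := 0)
      (a := -(δ / 2)) (b := δ / 2)
      (fun _ _ ↦ hlip₁.mono fun w hw ↦ (hball hw).1.1.2) ⟨by linarith, by linarith⟩
      (fun s hs ↦ ⟨hΨd s (hsδ s hs) _ (hU'U ht), hin s (hsδ s hs) _ (hU'U ht)⟩)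
      (fun s hs ↦ ⟨(hΨd (t + s) (hsum s hs) _ (hU'U hxU')).comp_const_add t s,
        hin _ (hsum s hs) _ (hU'U hxU')⟩) (by simp [hβ0 _ (hU'U ht)])
    have := huniq (x := -t) ⟨by linarith [ht'.2], by linarith [ht'.1]⟩
    simpa [hβ₀, hp₀] using this
  · -- the derivative of the spatial derivative
    have hmem0 : (0 : ℝ) ∈ Ioo (-δ) δ := ⟨by linarith, hδ0⟩
    have hG : ContinuousAt (fun q : ℝ × E ↦ (fderiv ℝ v (β q).1).comp (β q).2) (0, x₀) := by
      refine ContinuousAt.clm_comp ?_ hβc.snd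
      refine ContinuousAt.comp (g := fderiv ℝ v) ?_ hβc.fst
      rw [hβ₀]
      exact hdv.continuousAt
    have hG0 : (fderiv ℝ v (β (0, x₀)).1).comp (β (0, x₀)).2 = fderiv ℝ v x₀ := by
      rw [hβ₀]; ext; simp [hp₀]
    rw [hasDerivAt_iff_isLittleO, Asymptotics.isLittleO_iff]
    intro c hc
    have hGc := Metric.continuousAt_iff'.1 hG c hc
    rw [hG0, nhds_prod_eq, Filter.eventually_prod_iff] at hGc
    obtain ⟨qa, hqa, qb, hqb, hq⟩ := hGc
    obtain ⟨η, hη, hη'⟩ := Metric.eventually_nhds_iff.1 hqa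
    have hc1 : ContinuousAt (fun t ↦ (β (t, x₀)).1) 0 := (hΨd 0 hmem0 x₀ (hU'U hxU')).continuousAt
    have hc2 : ∀ᶠ t in 𝓝 0, (β (t, x₀)).1 ∈ {y | qb y} ∩ U := by
      refine hc1.eventually_mem ?_
      rw [hβ₀]
      exact Filter.inter_mem hqb hUn
    have hm : 0 < min η δ := lt_min hη hδ0
    filter_upwards [hc2, Ioo_mem_nhds (by linarith : -(min η δ) < 0) hm] with t ht ht'
    set y := (β (t, x₀)).1 with hy
    have hsub : Icc (-|t|) |t| ⊆ Ioo (-(min η δ)) (min η δ) := fun s hs ↦ by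
      have := abs_lt.2 ht'
      exact ⟨by linarith [hs.1], by linarith [hs.2]⟩
    have hδsub : ∀ s ∈ Icc (-|t|) |t|, s ∈ Ioo (-δ) δ := fun s hs ↦ by
      have h1 := hsub hs
      have h2 := min_le_right η δ
      exact ⟨by linarith [h1.1], by linarith [h1.2]⟩
    -- The base point `y = Ψ t x₀` moves with `t`, but `A 0 y = id` does not depend on it. So `y` is
    -- frozen and the mean value inequality is applied in `s` between `0` and `-t`; joint continuity
    -- of the right-hand side makes the bound `c` uniform in `y`.
    have key := Convex.norm_image_sub_le_of_norm_hasDerivWithin_le (C := c)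
      (f := fun s ↦ (β (s, y)).2 - s • fderiv ℝ v x₀) (s := Icc (-|t|) |t|) (x := 0) (y := -t)
      (fun s hs ↦ ((hAd s (hδsub s hs) y ht.2).sub
        ((hasDerivAt_id s).smul_const (fderiv ℝ v x₀))).hasDerivWithinAt)
      (fun s hs ↦ ?_) (convex_Icc _ _) ⟨by simp, by simp⟩
      ⟨by linarith [le_abs_self t], by linarith [neg_abs_le t]⟩
    · have e1 : (β (0, y)).2 = ContinuousLinearMap.id ℝ E := by rw [hβ0 y ht.2]
      have e2 : (β (-0, (β (0, x₀)).1)).2 = ContinuousLinearMap.id ℝ E := by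
        rw [hβ₀, neg_zero]; simp only [hp₀]; rw [hβ0 _ (hU'U hxU')]
      rw [e1] at key
      rw [e2]
      convert key using 2
      · simp; abel
      · simp
    · have := (hq (x := s) (hη' ?_) ht.1).le
      · rwa [dist_eq_norm, ← one_smul ℝ (fderiv ℝ v x₀)] at this
      · rw [Real.dist_eq, sub_zero]
        exact (abs_lt.2 (hsub hs)).trans_le (min_le_left _ _)

namespace AdjointSystem

/-! ### Vector fields and flows of `M` in a chart. -/

section LocalRep

variable {E : Type*} [NormedAddCommGroup E] [NormedSpace ℝ E]
  {H : Type*} [TopologicalSpace H] (I : ModelWithCorners ℝ E H)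
  {M : Type*} [TopologicalSpace M] [ChartedSpace H M]

/-- The representative of the vector field `v` in the preferred chart at `q₀`. -/
noncomputable def localRep (q₀ : M) (v : (x : M) → TangentSpace I x) : E → E :=
  VectorField.mpullbackWithin 𝓘(ℝ, E) I (extChartAt I q₀).symm v (range I)

variable [I.Boundaryless]

theorem mfderivWithin_range_extChartAt_symm_eq (q₀ : M) (x : E) :
    mfderivWithin 𝓘(ℝ, E) I (extChartAt I q₀).symm (range I) x =
      mfderiv 𝓘(ℝ, E) I (extChartAt I q₀).symm x := by
  rw [I.range_eq_univ, mfderivWithin_univ]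

theorem localRep_eq_mpullback (q₀ : M) (v : (x : M) → TangentSpace I x) :
    localRep I q₀ v = VectorField.mpullback 𝓘(ℝ, E) I (extChartAt I q₀).symm v := by
  rw [localRep, I.range_eq_univ, VectorField.mpullbackWithin_univ]

variable [IsManifold I ∞ M]

omit [I.Boundaryless] in
theorem isManifold_one : IsManifold I 1 M := .of_le (n := ∞) (by simp)

theorem mdifferentiableAt_extChartAt_symm {q₀ : M} {x : E} (hx : x ∈ (extChartAt I q₀).target) :
    MDifferentiableAt 𝓘(ℝ, E) I (extChartAt I q₀).symm x := by
  have := isManifold_one I (M := M)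
  have h := mdifferentiableWithinAt_extChartAt_symm (I := I) hx
  rwa [I.range_eq_univ, mdifferentiableWithinAt_univ] at h

theorem isInvertible_mfderiv_extChartAt_symm {q₀ : M} {x : E} (hx : x ∈ (extChartAt I q₀).target) :
    (mfderiv 𝓘(ℝ, E) I (extChartAt I q₀).symm x).IsInvertible := by
  have := isManifold_one I (M := M)
  rw [← mfderivWithin_range_extChartAt_symm_eq]
  exact isInvertible_mfderivWithin_extChartAt_symm hx

theorem mfderiv_extChartAt_symm_localRep {q₀ : M} {x : E} (hx : x ∈ (extChartAt I q₀).target)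
    (v : (x : M) → TangentSpace I x) :
    mfderiv 𝓘(ℝ, E) I (extChartAt I q₀).symm x (localRep I q₀ v x : E) =
      v ((extChartAt I q₀).symm x) := by
  rw [localRep_eq_mpullback, VectorField.mpullback_apply]
  exact ((isInvertible_mfderiv_extChartAt_symm I hx).inverse_apply_eq.1 rfl).symm

theorem localRep_eq_of_mfderiv_eq {q₀ : M} {x : E} (hx : x ∈ (extChartAt I q₀).target)
    {v : (x : M) → TangentSpace I x} {w : E}
    (h : mfderiv 𝓘(ℝ, E) I (extChartAt I q₀).symm x w = v ((extChartAt I q₀).symm x)) :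
    localRep I q₀ v x = w := by
  rw [localRep_eq_mpullback, VectorField.mpullback_apply]
  exact (isInvertible_mfderiv_extChartAt_symm I hx).inverse_apply_eq.2 h.symm

theorem contDiffAt_localRep [CompleteSpace E] {q₀ : M} {x : E} (hx : x ∈ (extChartAt I q₀).target)
    {v : (x : M) → TangentSpace I x}
    (hv : ContMDiff I I.tangent ∞ (fun x ↦ (⟨x, v x⟩ : TangentBundle I M))) :
    ContDiffAt ℝ ∞ (localRep I q₀ v) x := by
  rw [localRep_eq_mpullback]
  refine contMDiffAt_vectorSpace_iff_contDiffAt.1 ?_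
  refine ContMDiffAt.mpullback_vectorField_preimage (n := ∞) (hv _) ?_
    (isInvertible_mfderiv_extChartAt_symm I hx) (by simp)
  exact (contMDiffOn_extChartAt_symm q₀).contMDiffAt ((isOpen_extChartAt_target q₀).mem_nhds hx)

theorem hasMFDerivAt_extChartAt_symm_comp {q₀ : M} {v : (x : M) → TangentSpace I x} {c : ℝ → E}
    {t : ℝ} (hc : c t ∈ (extChartAt I q₀).target) (h : HasDerivAt c (localRep I q₀ v (c t)) t) :
    HasMFDerivAt 𝓘(ℝ, ℝ) I (fun s ↦ (extChartAt I q₀).symm (c s)) t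
      ((1 : ℝ →L[ℝ] ℝ).smulRight (v ((extChartAt I q₀).symm (c t)))) := by
  have h1 := (mdifferentiableAt_extChartAt_symm I hc).hasMFDerivAt.comp t
    h.hasFDerivAt.hasMFDerivAt
  refine h1.congr_mfderiv ?_
  refine ContinuousLinearMap.ext_ring ?_
  exact (congrArg (mfderiv 𝓘(ℝ, E) I (extChartAt I q₀).symm (c t))
    (one_smul ℝ (localRep I q₀ v (c t) : E))).trans
    ((mfderiv_extChartAt_symm_localRep I hc v).trans (one_smul ℝ _).symm)

variable [CompleteSpace E] [T2Space M]

omit [CompleteSpace E] in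
-- Frees `flow` from its arbitrary choice of curve: integral curves in a Hausdorff manifold without
-- boundary are unique, and the two intervals of definition meet in an interval containing `0` and
-- `t`.
theorem flow_eq_of_isMIntegralCurveOn {v : (x : M) → TangentSpace I x}
    (hv : ContMDiff I I.tangent ∞ (fun x ↦ (⟨x, v x⟩ : TangentBundle I M)))
    {γ : ℝ → M} {δ t : ℝ} (hγ : IsMIntegralCurveOn γ v (Ioo (-δ) δ)) (ht : t ∈ Ioo (-δ) δ) :
    flow I v t (γ 0) = γ t := by
  have := isManifold_one I (M := M)
  have h0 : (0 : ℝ) ∈ Ioo (-δ) δ := ⟨by linarith [ht.1, ht.2], by linarith [ht.1, ht.2]⟩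
  have h : ∃ γ' : ℝ → M, γ' 0 = γ 0 ∧
      ∃ a b : ℝ, 0 ∈ Ioo a b ∧ t ∈ Ioo a b ∧ IsMIntegralCurveOn γ' v (Ioo a b) :=
    ⟨γ, rfl, -δ, δ, h0, ht, hγ⟩
  rw [flow, dif_pos h]
  obtain ⟨h1, a, b, h0', ht', hγ'⟩ := h.choose_spec
  have hsub : Ioo (max a (-δ)) (min b δ) = Ioo a b ∩ Ioo (-δ) δ := Ioo_inter_Ioo.symm
  have hI : ∀ s, s ∈ Ioo a b → s ∈ Ioo (-δ) δ → s ∈ Ioo (max a (-δ)) (min b δ) := fun s h h' ↦ by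
    rw [hsub]; exact ⟨h, h'⟩
  exact isMIntegralCurveOn_Ioo_eqOn_of_contMDiff_boundaryless (I := I) (hI 0 h0' h0)
    (hv.of_le (by simp)) (hγ'.mono (hsub ▸ inter_subset_left)) (hγ.mono (hsub ▸ inter_subset_right))
    h1 (hI t ht' ht)

/-- The flow of `v` in the chart at `q₀`, near the point with coordinates `x₀`. -/
theorem exists_local_flow {v : (x : M) → TangentSpace I x}
    (hv : ContMDiff I I.tangent ∞ (fun x ↦ (⟨x, v x⟩ : TangentBundle I M)))
    {q₀ : M} {x₀ : E} (hx₀ : x₀ ∈ (extChartAt I q₀).target) :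
    ∃ (δ : ℝ) (U : Set E) (Ψ : ℝ → E → E) (A : ℝ → E → E →L[ℝ] E), 0 < δ ∧ U ∈ 𝓝 x₀ ∧
      (∀ t ∈ Ioo (-δ) δ, ∀ x ∈ U, flow I v t ((extChartAt I q₀).symm x) =
          (extChartAt I q₀).symm (Ψ t x) ∧ Ψ t x ∈ (extChartAt I q₀).target ∧
        HasFDerivAt (Ψ t) (A t x) x) ∧
      (∀ᶠ t in 𝓝 0, Ψ t x₀ ∈ interior U ∧ Ψ (-t) (Ψ t x₀) = x₀) ∧
      HasDerivAt (fun t ↦ Ψ t x₀) (localRep I q₀ v x₀) 0 ∧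
      HasDerivAt (fun t ↦ A (-t) (Ψ t x₀)) (-fderiv ℝ (localRep I q₀ v) x₀) 0 := by
  obtain ⟨δ, U, Ψ, A, hδ, hU, h0, h1, h2, h3⟩ :=
    ((contDiffAt_localRep I hx₀ hv).of_le (WithTop.coe_le_coe.2 le_top :
      ((2 : ℕ∞) : WithTop ℕ∞) ≤ ∞)).exists_local_flow ((isOpen_extChartAt_target (I := I) q₀).mem_nhds hx₀)
  have hd0 : (0 : ℝ) ∈ Ioo (-δ) δ := ⟨by linarith, hδ⟩
  have hxU : x₀ ∈ U := mem_of_mem_nhds hU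
  have hΨ0 := h0 x₀ hxU
  have hder := (h1 0 hd0 x₀ hxU).1
  rw [hΨ0] at hder
  refine ⟨δ, U, Ψ, A, hδ, hU, fun t ht x hx ↦ ⟨?_, (h1 t ht x hx).2⟩, ?_, hder, h3⟩
  · have hcurve : IsMIntegralCurveOn (fun s ↦ (extChartAt I q₀).symm (Ψ s x)) v (Ioo (-δ) δ) :=
      fun s hs ↦ (hasMFDerivAt_extChartAt_symm_comp I (h1 s hs x hx).2.1
        (h1 s hs x hx).1).hasMFDerivWithinAt
    have := flow_eq_of_isMIntegralCurveOn I hv hcurve ht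
    rwa [h0 x hx] at this
  · have hc : ∀ᶠ t in 𝓝 0, Ψ t x₀ ∈ interior U := by
      refine hder.continuousAt.eventually_mem ?_
      rw [hΨ0]
      exact isOpen_interior.mem_nhds (mem_interior_iff_mem_nhds.2 hU)
    filter_upwards [hc, h2] with t ht ht' using ⟨ht, ht'.2⟩

end LocalRep

/-! ### Charts of the cotangent bundle. -/

section CotangentChart

variable {E : Type*} [NormedAddCommGroup E] [NormedSpace ℝ E]
  {H : Type*} [TopologicalSpace H] (I : ModelWithCorners ℝ E H) [I.Boundaryless]
  {M : Type*} [TopologicalSpace M] [ChartedSpace H M] [IsManifold I ∞ M]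

omit [I.Boundaryless] in
theorem mem_extChartAt_cotangent_source_iff (z₀ z : CotangentBundle I M) :
    z ∈ (extChartAt (cotangentModel I) z₀).source ↔ z.1 ∈ (extChartAt I z₀.1).source := by
  rw [extChartAt_source, extChartAt_source, FiberBundle.chartedSpace_chartAt]
  simp only [mfld_simps]
  exact ⟨fun h ↦ h.2, fun h ↦ ⟨⟨h, mem_univ _⟩, h⟩⟩

/-- The preferred chart of `T*M` sends `(q, p)` to the coordinates of `q` and the pullback of `p`
by the inverse chart. -/
theorem extChartAt_cotangent_apply {z₀ z : CotangentBundle I M}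
    (hz : z.1 ∈ (extChartAt I z₀.1).source) :
    extChartAt (cotangentModel I) z₀ z = (extChartAt I z₀.1 z.1, (z.2 : E →L[ℝ] ℝ).comp
      (mfderiv 𝓘(ℝ, E) I (extChartAt I z₀.1).symm (extChartAt I z₀.1 z.1) : E →L[ℝ] E)) := by
  rw [extChartAt_source] at hz
  have h1 := TangentBundle.symmL_trivializationAt (I := I) hz
  rw [mfderivWithin_range_extChartAt_symm_eq] at h1
  have h2 := hom_chart (F₁ := E) (F₂ := ℝ) (HB := H) (E₁ := (TangentSpace I : M → Type _))
    (E₂ := fun _ : M ↦ ℝ) (𝕜 := ℝ) z₀ z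
  rw [extChartAt_coe, Function.comp_apply]
  refine (congrArg _ h2).trans ?_
  refine Prod.ext rfl ?_
  change ContinuousLinearMap.inCoordinates E (TangentSpace I) ℝ (fun _ : M ↦ ℝ)
    z₀.1 z.1 z₀.1 z.1 z.2 = _
  rw [ContinuousLinearMap.inCoordinates, h1]
  ext u
  simp
  rfl

end CotangentChart

/-! ### The cotangent lifted flow in coordinates. -/

/-- The Hamiltonian vector field of `⟨p, V(x)⟩` on `E × E*`. -/
noncomputable def liftRep {E : Type*} [NormedAddCommGroup E] [NormedSpace ℝ E] (V : E → E)
    (w : E × (E →L[ℝ] ℝ)) : E × (E →L[ℝ] ℝ) :=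
  (V w.1, -(w.2.comp (fderiv ℝ V w.1)))

section CotangentFlow

variable {E : Type*} [NormedAddCommGroup E] [NormedSpace ℝ E]
  {H : Type*} [TopologicalSpace H] (I : ModelWithCorners ℝ E H) [I.Boundaryless]
  {M : Type*} [TopologicalSpace M] [ChartedSpace H M] [IsManifold I ∞ M]

/-- The derivative of a map which reads `Ψ` in the chart at `q₀`. -/
theorem mfderiv_comp_mfderiv_extChartAt_symm {q₀ : M} {φ : M → M} {Ψ : E → E} {A : E →L[ℝ] E}
    {x : E} (hx : x ∈ (extChartAt I q₀).target) (hΨx : Ψ x ∈ (extChartAt I q₀).target)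
    (hΨ : HasFDerivAt Ψ A x)
    (hφ : ∀ᶠ y in 𝓝 x, φ ((extChartAt I q₀).symm y) = (extChartAt I q₀).symm (Ψ y)) :
    (mfderiv I I φ ((extChartAt I q₀).symm x) : E →L[ℝ] E).comp
      (mfderiv 𝓘(ℝ, E) I (extChartAt I q₀).symm x : E →L[ℝ] E) =
    (mfderiv 𝓘(ℝ, E) I (extChartAt I q₀).symm (Ψ x) : E →L[ℝ] E).comp A := by
  set y := (extChartAt I q₀).symm x with hy
  have hys : y ∈ (extChartAt I q₀).source := (extChartAt I q₀).map_target hx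
  have hyx : extChartAt I q₀ y = x := (extChartAt I q₀).right_inv hx
  have hchart : MDifferentiableAt I 𝓘(ℝ, E) (extChartAt I q₀) y :=
    mdifferentiableAt_extChartAt (by rwa [extChartAt_source] at hys)
  have hΨ' : HasMFDerivAt 𝓘(ℝ, E) 𝓘(ℝ, E) Ψ (extChartAt I q₀ y) A := by
    rw [hyx]; exact hΨ.hasMFDerivAt
  have hΨy : MDifferentiableAt 𝓘(ℝ, E) I (extChartAt I q₀).symm (Ψ (extChartAt I q₀ y)) := by
    rw [hyx]; exact mdifferentiableAt_extChartAt_symm I hΨx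
  have h1 := hΨy.hasMFDerivAt.comp y (hΨ'.comp y hchart.hasMFDerivAt)
  have hev : φ =ᶠ[𝓝 y] (extChartAt I q₀).symm ∘ Ψ ∘ extChartAt I q₀ := by
    have hc : Filter.Tendsto (extChartAt I q₀) (𝓝 y) (𝓝 x) := by
      have := continuousAt_extChartAt' (I := I) hys
      rwa [ContinuousAt, hyx] at this
    filter_upwards [hc.eventually hφ, extChartAt_source_mem_nhds' (I := I) hys] with y' h h'
    rw [(extChartAt I q₀).left_inv h'] at h
    exact h
  have h2 := (h1.congr_of_eventuallyEq hev).mfderiv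
  have hinv := mfderiv_extChartAt_comp_mfderivWithin_extChartAt_symm (I := I) hx
  rw [mfderivWithin_range_extChartAt_symm_eq] at hinv
  refine ContinuousLinearMap.ext fun u ↦ ?_
  have h3 : (mfderiv I I φ y : E →L[ℝ] E) (mfderiv 𝓘(ℝ, E) I (extChartAt I q₀).symm x u : E) =
      (mfderiv 𝓘(ℝ, E) I (extChartAt I q₀).symm (Ψ (extChartAt I q₀ y)) : E →L[ℝ] E)
        (A ((mfderiv I 𝓘(ℝ, E) (extChartAt I q₀) y : E →L[ℝ] E)
          (mfderiv 𝓘(ℝ, E) I (extChartAt I q₀).symm x u : E))) :=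
    congrArg (fun T : E →L[ℝ] E ↦ T (mfderiv 𝓘(ℝ, E) I (extChartAt I q₀).symm x u : E)) h2
  have h4 : (mfderiv I 𝓘(ℝ, E) (extChartAt I q₀) y : E →L[ℝ] E)
          (mfderiv 𝓘(ℝ, E) I (extChartAt I q₀).symm x u : E) = u :=
    congrArg (fun T : E →L[ℝ] E ↦ T u) hinv
  rw [h4, hyx] at h3
  exact h3

variable [CompleteSpace E] [T2Space M]

/-- The cotangent lifted flow, read in a chart of `T*M`, has the velocity `liftRep`. -/
theorem hasDerivAt_extChartAt_cotangentFlow {v : (x : M) → TangentSpace I x}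
    (hv : ContMDiff I I.tangent ∞ (fun x ↦ (⟨x, v x⟩ : TangentBundle I M)))
    {z₀ z : CotangentBundle I M} (hz : z ∈ (extChartAt (cotangentModel I) z₀).source) :
    (∀ᶠ t in 𝓝 (0 : ℝ), cotangentFlow I v t z ∈ (extChartAt (cotangentModel I) z₀).source) ∧
    HasDerivAt (fun t ↦ extChartAt (cotangentModel I) z₀ (cotangentFlow I v t z))
      (liftRep (localRep I z₀.1 v) (extChartAt (cotangentModel I) z₀ z)) 0 := by
  rw [mem_extChartAt_cotangent_source_iff] at hz
  set x₀ := extChartAt I z₀.1 z.1 with hx₀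
  have hx₀t : x₀ ∈ (extChartAt I z₀.1).target := (extChartAt I z₀.1).map_source hz
  have hqx : (extChartAt I z₀.1).symm x₀ = z.1 := (extChartAt I z₀.1).left_inv hz
  obtain ⟨δ, U, Ψ, A, hδ, hU, hflow, hinv, hΨd, hAd⟩ := exists_local_flow I hv hx₀t
  have hxU := mem_of_mem_nhds hU
  set p : E →L[ℝ] ℝ := (z.2 : E →L[ℝ] ℝ).comp
      (mfderiv 𝓘(ℝ, E) I (extChartAt I z₀.1).symm x₀ : E →L[ℝ] E) with hp
  -- Stated for operators on `E`, so that the base point can be rewritten without disturbing tangent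
  -- space types.
  have comp_aux (P : E →L[ℝ] ℝ) (C : E →L[ℝ] E) (B : E → E →L[ℝ] E) {x y : E} {D : E →L[ℝ] E}
      (hxy : x = y) (h : C.comp (B y) = D) : (P.comp C).comp (B x) = P.comp D := by
    rw [hxy, ContinuousLinearMap.comp_assoc, h]
  have hmain : ∀ᶠ t in 𝓝 (0 : ℝ),
      cotangentFlow I v t z ∈ (extChartAt (cotangentModel I) z₀).source ∧
      extChartAt (cotangentModel I) z₀ (cotangentFlow I v t z) =
        (Ψ t x₀, p.comp (A (-t) (Ψ t x₀))) := by
    filter_upwards [hinv, Ioo_mem_nhds (by linarith : -δ < 0) hδ] with t ht htδ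
    have hmtδ : -t ∈ Ioo (-δ) δ := ⟨by linarith [htδ.2], by linarith [htδ.1]⟩
    obtain ⟨h1, h2, -⟩ := hflow t htδ x₀ hxU
    obtain ⟨-, h3, h4⟩ := hflow (-t) hmtδ (Ψ t x₀) (interior_subset ht.1)
    rw [hqx] at h1
    have hy : flow I v t z.1 ∈ (extChartAt I z₀.1).source := by
      rw [h1]; exact (extChartAt I z₀.1).map_target h2
    have hφy : extChartAt I z₀.1 (flow I v t z.1) = Ψ t x₀ := by
      rw [h1]; exact (extChartAt I z₀.1).right_inv h2
    refine ⟨(mem_extChartAt_cotangent_source_iff I z₀ _).2 hy, ?_⟩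
    rw [extChartAt_cotangent_apply I (z := cotangentFlow I v t z) hy]
    -- The derivative of `Φ_{-t}` at `Φ_t q` needs the coordinate description on a neighbourhood of
    -- `Ψ t x₀`, hence the interior of `U`.
    have h5 := mfderiv_comp_mfderiv_extChartAt_symm I (φ := flow I v (-t)) h2 h3 h4 (by
      filter_upwards [isOpen_interior.mem_nhds ht.1] with y hy'
      exact (hflow (-t) hmtδ y (interior_subset hy')).1)
    rw [ht.2, ← h1] at h5
    refine Prod.ext hφy ?_
    exact comp_aux (z.2 : E →L[ℝ] ℝ) (mfderiv I I (flow I v (-t)) (flow I v t z.1) : E →L[ℝ] E)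
      (fun x' ↦ (mfderiv 𝓘(ℝ, E) I (extChartAt I z₀.1).symm x' : E →L[ℝ] E)) hφy h5
  refine ⟨hmain.mono fun t h ↦ h.1, ?_⟩
  have hd : HasDerivAt (fun t ↦ (Ψ t x₀, p.comp (A (-t) (Ψ t x₀))))
      (localRep I z₀.1 v x₀, p.comp (-fderiv ℝ (localRep I z₀.1 v) x₀)) 0 := by
    refine hΨd.prodMk ?_
    exact ((ContinuousLinearMap.compL ℝ E E ℝ p).hasFDerivAt.comp_hasDerivAt (0 : ℝ) hAd)
  have hcoord : extChartAt (cotangentModel I) z₀ z = (x₀, p) := extChartAt_cotangent_apply I hz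
  rw [hcoord, liftRep]
  rw [ContinuousLinearMap.comp_neg] at hd
  exact hd.congr_of_eventuallyEq (hmain.mono fun t h ↦ h.2)

end CotangentFlow

/-! ### Brackets and pairings of Hamiltonian lifts on `E × E*`. -/

section VectorSpace

variable {E : Type*} [NormedAddCommGroup E] [NormedSpace ℝ E]

theorem hasFDerivAt_liftRep {V : E → E} {w : E × (E →L[ℝ] ℝ)} (hV : ContDiffAt ℝ 2 V w.1) :
    ∃ L : (E × (E →L[ℝ] ℝ)) →L[ℝ] E × (E →L[ℝ] ℝ), HasFDerivAt (liftRep V) L w ∧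
      ∀ a, L a = (fderiv ℝ V w.1 a.1,
        -(w.2.comp (fderiv ℝ (fderiv ℝ V) w.1 a.1) + a.2.comp (fderiv ℝ V w.1))) := by
  have h1 : HasFDerivAt V (fderiv ℝ V w.1) w.1 := (hV.differentiableAt (by norm_num)).hasFDerivAt
  have h2 : HasFDerivAt (fderiv ℝ V) (fderiv ℝ (fderiv ℝ V) w.1) w.1 :=
    ((hV.fderiv_right (m := 1) (by norm_num)).differentiableAt (by norm_num)).hasFDerivAt
  refine ⟨_, (h1.comp w hasFDerivAt_fst).prodMk
    (hasFDerivAt_snd.clm_comp (h2.comp w hasFDerivAt_fst)).neg, fun a ↦ ?_⟩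
  refine Prod.ext rfl ?_
  ext u
  simp

theorem contDiffAt_liftRep {V : E → E} {w : E × (E →L[ℝ] ℝ)} (hV : ContDiffAt ℝ ∞ V w.1) :
    ContDiffAt ℝ ∞ (liftRep V) w := by
  have h1 : ContDiffAt ℝ ∞ (fderiv ℝ V) w.1 := hV.fderiv_right (by simp)
  exact (hV.comp w contDiffAt_fst).prodMk
    (contDiffAt_snd.clm_comp (h1.comp w contDiffAt_fst)).neg

/-- By symmetry of the second derivatives the momentum component is `-p ∘ D[V, W]`, which is why the
bracket must vanish on a neighbourhood and not only at `w.1`. -/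
theorem lieBracket_liftRep_eq_zero {V W : E → E} {w : E × (E →L[ℝ] ℝ)}
    (hV : ContDiffAt ℝ 2 V w.1) (hW : ContDiffAt ℝ 2 W w.1)
    (h : ∀ᶠ x in 𝓝 w.1, VectorField.lieBracket ℝ V W x = 0) :
    VectorField.lieBracket ℝ (liftRep V) (liftRep W) w = 0 := by
  obtain ⟨LV, hLV, hLV'⟩ := hasFDerivAt_liftRep hV
  obtain ⟨LW, hLW, hLW'⟩ := hasFDerivAt_liftRep hW
  have hV1 : HasFDerivAt V (fderiv ℝ V w.1) w.1 := (hV.differentiableAt (by norm_num)).hasFDerivAt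
  have hW1 : HasFDerivAt W (fderiv ℝ W w.1) w.1 := (hW.differentiableAt (by norm_num)).hasFDerivAt
  have hV2 : HasFDerivAt (fderiv ℝ V) (fderiv ℝ (fderiv ℝ V) w.1) w.1 :=
    ((hV.fderiv_right (m := 1) (by norm_num)).differentiableAt (by norm_num)).hasFDerivAt
  have hW2 : HasFDerivAt (fderiv ℝ W) (fderiv ℝ (fderiv ℝ W) w.1) w.1 :=
    ((hW.fderiv_right (m := 1) (by norm_num)).differentiableAt (by norm_num)).hasFDerivAt
  have hb := (hW2.clm_apply hV1).sub (hV2.clm_apply hW1)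
  have hz := hb.unique ((hasFDerivAt_const (0 : E) w.1).congr_of_eventuallyEq h)
  have hsV := hV.isSymmSndFDerivAt (by simp)
  have hsW := hW.isSymmSndFDerivAt (by simp)
  rw [VectorField.lieBracket, hLV.fderiv, hLW.fderiv, hLV', hLW']
  refine Prod.ext ?_ ?_
  · simpa [liftRep, VectorField.lieBracket] using h.self_of_nhds
  · ext u
    have hu := congrArg w.2 (DFunLike.congr_fun hz u)
    have e1 := congrArg w.2 (hsV u (W w.1))
    have e2 := congrArg w.2 (hsW u (V w.1))
    simp [liftRep] at hu e1 e2 ⊢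
    linarith

/-- The pairing of the momentum with a field commuting with `V` is invariant under `liftRep V`. -/
theorem hasDerivWithinAt_pairing {V W : E → E} {c : ℝ → E × (E →L[ℝ] ℝ)} {s : Set ℝ} {t : ℝ}
    (hW : DifferentiableAt ℝ W (c t).1)
    (h : VectorField.lieBracket ℝ W V (c t).1 = 0)
    (hc : HasDerivWithinAt c (liftRep V (c t)) s t) :
    HasDerivWithinAt (fun r ↦ (c r).2 (W (c r).1)) 0 s t := by
  have hc₁ : HasDerivWithinAt (fun r ↦ (c r).1) (liftRep V (c t)).1 s t :=
    (ContinuousLinearMap.fst ℝ E (E →L[ℝ] ℝ)).hasFDerivAt.comp_hasDerivWithinAt t hc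
  have hc₂ : HasDerivWithinAt (fun r ↦ (c r).2) (liftRep V (c t)).2 s t :=
    (ContinuousLinearMap.snd ℝ E (E →L[ℝ] ℝ)).hasFDerivAt.comp_hasDerivWithinAt t hc
  have h1 := hc₂.clm_apply (hW.hasFDerivAt.comp_hasDerivWithinAt t hc₁)
  refine h1.congr_deriv ?_
  have h2 := congrArg (c t).2 h
  rw [VectorField.lieBracket] at h2
  simp [liftRep] at h2 ⊢
  linarith

end VectorSpace

/-! ### Transfer from coordinates to the manifold. -/

section Manifold

variable {E : Type*} [NormedAddCommGroup E] [NormedSpace ℝ E] [CompleteSpace E]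
  {H : Type*} [TopologicalSpace H] (I : ModelWithCorners ℝ E H) [I.Boundaryless]
  {M : Type*} [TopologicalSpace M] [ChartedSpace H M] [IsManifold I ∞ M]

omit [I.Boundaryless] in
/-- A vector field with smooth local representatives is smooth. -/
theorem contMDiff_of_contDiffAt_localRep {v : (x : M) → TangentSpace I x}
    (h : ∀ q₀ : M, ContDiffAt ℝ ∞ (localRep I q₀ v) (extChartAt I q₀ q₀)) :
    ContMDiff I I.tangent ∞ (fun x ↦ (⟨x, v x⟩ : TangentBundle I M)) := by
  have := isManifold_one I (M := M)
  intro q₀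
  have h1 : ContMDiffAt I I.tangent ∞ (fun x ↦ (⟨x, VectorField.mpullback I 𝓘(ℝ, E)
      (extChartAt I q₀) (localRep I q₀ v) x⟩ : TangentBundle I M)) q₀ :=
    ContMDiffAt.mpullback_vectorField_preimage (n := ∞)
      (contMDiffAt_vectorSpace_iff_contDiffAt.2 (h q₀)) contMDiffAt_extChartAt
      (isInvertible_mfderiv_extChartAt (mem_extChartAt_source q₀)) (by simp)
  refine h1.congr_of_eventuallyEq ?_
  have h2 := VectorField.eventuallyEq_mpullback_mpullbackWithin_extChartAt (I := I) (s := univ)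
    (x := q₀) v
  rw [nhdsWithin_univ] at h2
  filter_upwards [h2] with x hx
  rw [localRep, ← hx]

omit [CompleteSpace E] [I.Boundaryless] in
-- The preferred chart at `q₀` induces the identity on the tangent space at `q₀`, which is modelled
-- on `E` through that very chart.
theorem localRep_extChartAt_self (q₀ : M) (v : (x : M) → TangentSpace I x) :
    localRep I q₀ v (extChartAt I q₀ q₀) = v q₀ := by
  have := isManifold_one I (M := M)
  have h := mfderivWithin_extChartAt_symm_inverse_apply (I := I) (x := q₀)
    (v ((extChartAt I q₀).symm (extChartAt I q₀ q₀)) : E)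
  rw [localRep, VectorField.mpullbackWithin_apply]
  refine h.trans ?_
  rw [extChartAt_to_inv]

/-- Naturality of the Lie bracket under pullback by the inverse chart. -/
theorem lieBracket_localRep_eq_zero {v w : (x : M) → TangentSpace I x}
    (hv : ContMDiff I I.tangent ∞ (fun x ↦ (⟨x, v x⟩ : TangentBundle I M)))
    (hw : ContMDiff I I.tangent ∞ (fun x ↦ (⟨x, w x⟩ : TangentBundle I M)))
    (h : ∀ x, VectorField.mlieBracket I v w x = 0) {q₀ : M} {x : E}
    (hx : x ∈ (extChartAt I q₀).target) :
    VectorField.lieBracket ℝ (localRep I q₀ v) (localRep I q₀ w) x = 0 := by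
  have hmin : minSmoothness ℝ 2 ≤ ∞ := by
    rw [minSmoothness_of_isRCLikeNormedField]
    exact (WithTop.coe_le_coe.2 le_top : ((2 : ℕ∞) : WithTop ℕ∞) ≤ ∞)
  have := isManifold_one I (M := M)
  have : IsManifold I (minSmoothness ℝ 2) M := .of_le hmin
  have h1 := VectorField.mpullback_mlieBracket (I := 𝓘(ℝ, E)) (I' := I) (n := ∞) (V := v) (W := w)
    (f := (extChartAt I q₀).symm) (x₀ := x)
    ((hv _).mdifferentiableAt (by simp)) ((hw _).mdifferentiableAt (by simp))
    ((contMDiffOn_extChartAt_symm q₀).contMDiffAt ((isOpen_extChartAt_target q₀).mem_nhds hx)) hmin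
  have h2 : VectorField.mpullback 𝓘(ℝ, E) I (extChartAt I q₀).symm
      (VectorField.mlieBracket I v w) x = 0 := by
    rw [VectorField.mpullback_apply, h]
    exact ContinuousLinearMap.map_zero _
  have h3 (A B : (x : E) → TangentSpace 𝓘(ℝ, E) x) : VectorField.mlieBracket 𝓘(ℝ, E) A B x =
      VectorField.lieBracket ℝ A B x := by
    rw [← VectorField.mlieBracketWithin_univ, VectorField.mlieBracketWithin_eq_lieBracketWithin]
    exact congrFun VectorField.lieBracketWithin_univ x
  rw [localRep_eq_mpullback, localRep_eq_mpullback]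
  exact (h3 _ _).symm.trans (h1.symm.trans h2)

omit [CompleteSpace E] [IsManifold I ∞ M] in
theorem mlieBracket_eq_zero_of_lieBracket_localRep {v w : (x : M) → TangentSpace I x} {q₀ : M}
    (h : VectorField.lieBracket ℝ (localRep I q₀ v) (localRep I q₀ w) (extChartAt I q₀ q₀) = 0) :
    VectorField.mlieBracket I v w q₀ = 0 := by
  rw [← VectorField.mlieBracketWithin_univ, VectorField.mlieBracketWithin_apply, preimage_univ,
    univ_inter]
  have h' : VectorField.lieBracketWithin ℝ (localRep I q₀ v) (localRep I q₀ w) (range I)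
      (extChartAt I q₀ q₀) = 0 := by
    rw [I.range_eq_univ, VectorField.lieBracketWithin_univ, h]
  exact (congrArg _ h').trans (ContinuousLinearMap.map_zero _)

variable [T2Space M]

/-- The link between the geometric definition and coordinates. It holds on the whole chart target,
so both sides may be differentiated. -/
theorem localRep_cotangentLift {v : (x : M) → TangentSpace I x}
    (hv : ContMDiff I I.tangent ∞ (fun x ↦ (⟨x, v x⟩ : TangentBundle I M)))
    {z₀ : CotangentBundle I M} {w : E × (E →L[ℝ] ℝ)}
    (hw : w ∈ (extChartAt (cotangentModel I) z₀).target) :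
    localRep (cotangentModel I) z₀ (cotangentLift I v) w = liftRep (localRep I z₀.1 v) w := by
  refine localRep_eq_of_mfderiv_eq (cotangentModel I) hw ?_
  set z := (extChartAt (cotangentModel I) z₀).symm w with hz
  have hzs : z ∈ (extChartAt (cotangentModel I) z₀).source :=
    (extChartAt (cotangentModel I) z₀).map_target hw
  have hzw : extChartAt (cotangentModel I) z₀ z = w :=
    (extChartAt (cotangentModel I) z₀).right_inv hw
  obtain ⟨h1, h2⟩ := hasDerivAt_extChartAt_cotangentFlow I hv hzs
  have h0 : extChartAt (cotangentModel I) z₀ (cotangentFlow I v 0 z) = w := by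
    rw [cotangentFlow_zero, hzw]
  have h3 : MDifferentiableAt 𝓘(ℝ, E × (E →L[ℝ] ℝ)) (cotangentModel I)
      (extChartAt (cotangentModel I) z₀).symm
      (extChartAt (cotangentModel I) z₀ (cotangentFlow I v 0 z)) := by
    rw [h0]; exact mdifferentiableAt_extChartAt_symm (cotangentModel I) hw
  have h4 := h3.hasMFDerivAt.comp (0 : ℝ) h2.hasFDerivAt.hasMFDerivAt
  have h5 := (h4.congr_of_eventuallyEq (f₁ := fun t ↦ cotangentFlow I v t z) (h1.mono fun t ht ↦
    ((extChartAt (cotangentModel I) z₀).left_inv ht).symm)).mfderiv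
  have h6 : cotangentLift I v z = (mfderiv 𝓘(ℝ, E × (E →L[ℝ] ℝ)) (cotangentModel I)
      (extChartAt (cotangentModel I) z₀).symm
      (extChartAt (cotangentModel I) z₀ (cotangentFlow I v 0 z)) :
      E × (E →L[ℝ] ℝ) →L[ℝ] E × (E →L[ℝ] ℝ))
      ((1 : ℝ) • liftRep (localRep I z₀.1 v) (extChartAt (cotangentModel I) z₀ z)) :=
    congrArg (fun T : ℝ →L[ℝ] E × (E →L[ℝ] ℝ) ↦ T 1) h5
  rw [one_smul, hzw, h0] at h6
  exact h6.symm

theorem contMDiff_cotangentLift {v : (x : M) → TangentSpace I x}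
    (hv : ContMDiff I I.tangent ∞ (fun x ↦ (⟨x, v x⟩ : TangentBundle I M))) :
    ContMDiff (cotangentModel I) (cotangentModel I).tangent ∞ (fun z ↦ (⟨z, cotangentLift I v z⟩ :
      TangentBundle (cotangentModel I) (CotangentBundle I M))) := by
  refine contMDiff_of_contDiffAt_localRep (cotangentModel I) fun z₀ ↦ ?_
  have hz₀ := mem_extChartAt_target (I := cotangentModel I) z₀
  refine ContDiffAt.congr_of_eventuallyEq (contDiffAt_liftRep (V := localRep I z₀.1 v) ?_)
    (Filter.eventuallyEq_of_mem ((isOpen_extChartAt_target z₀).mem_nhds hz₀)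
      fun w hw ↦ localRep_cotangentLift I hv hw)
  rw [extChartAt_cotangent_apply I (mem_extChartAt_source z₀.1)]
  exact contDiffAt_localRep I (mem_extChartAt_target z₀.1) hv

theorem mlieBracket_cotangentLift_eq_zero {v w : (x : M) → TangentSpace I x}
    (hv : ContMDiff I I.tangent ∞ (fun x ↦ (⟨x, v x⟩ : TangentBundle I M)))
    (hw : ContMDiff I I.tangent ∞ (fun x ↦ (⟨x, w x⟩ : TangentBundle I M)))
    (h : ∀ x, VectorField.mlieBracket I v w x = 0) (z : CotangentBundle I M) :
    VectorField.mlieBracket (cotangentModel I) (cotangentLift I v) (cotangentLift I w) z = 0 := by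
  refine mlieBracket_eq_zero_of_lieBracket_localRep (cotangentModel I) ?_
  have hz := (isOpen_extChartAt_target z).mem_nhds (mem_extChartAt_target (I := cotangentModel I) z)
  have e1 := Filter.eventuallyEq_of_mem hz fun x hx ↦ localRep_cotangentLift I hv hx
  have e2 := Filter.eventuallyEq_of_mem hz fun x hx ↦ localRep_cotangentLift I hw hx
  rw [e1.lieBracket_vectorField_eq e2, extChartAt_cotangent_apply I (mem_extChartAt_source z.1)]
  have hx := mem_extChartAt_target (I := I) z.1
  have h2 : ((2 : ℕ∞) : WithTop ℕ∞) ≤ ∞ := WithTop.coe_le_coe.2 le_top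
  refine lieBracket_liftRep_eq_zero ((contDiffAt_localRep I hx hv).of_le h2)
    ((contDiffAt_localRep I hx hw).of_le h2) ?_
  filter_upwards [(isOpen_extChartAt_target (I := I) z.1).mem_nhds hx] with x hx'
  exact lieBracket_localRep_eq_zero I hv hw h hx'

/-- In charts the projection is `Prod.fst`, and the first component of `liftRep V` is `V`. -/
theorem mfderiv_proj_cotangentLift {v : (x : M) → TangentSpace I x}
    (hv : ContMDiff I I.tangent ∞ (fun x ↦ (⟨x, v x⟩ : TangentBundle I M)))
    (z : CotangentBundle I M) :
    mfderiv (cotangentModel I) I (TotalSpace.proj : CotangentBundle I M → M) z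
      (cotangentLift I v z) = v z.1 := by
  set w := extChartAt (cotangentModel I) z z with hw
  have hwt : w ∈ (extChartAt (cotangentModel I) z).target := mem_extChartAt_target z
  have hzw : (extChartAt (cotangentModel I) z).symm w = z := extChartAt_to_inv z
  have hw1 : w.1 = extChartAt I z.1 z.1 := by
    rw [hw, extChartAt_cotangent_apply I (mem_extChartAt_source z.1)]
  have hw1t : w.1 ∈ (extChartAt I z.1).target := hw1 ▸ mem_extChartAt_target z.1
  have hproj : (TotalSpace.proj : CotangentBundle I M → M) ∘ (extChartAt (cotangentModel I) z).symm
      =ᶠ[𝓝 w] (extChartAt I z.1).symm ∘ Prod.fst := by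
    filter_upwards [(isOpen_extChartAt_target z).mem_nhds hwt] with y hy
    have hys := (mem_extChartAt_cotangent_source_iff I z _).1
      ((extChartAt (cotangentModel I) z).map_target hy)
    have h1 := (extChartAt (cotangentModel I) z).right_inv hy
    rw [extChartAt_cotangent_apply I hys] at h1
    rw [Function.comp_apply, Function.comp_apply, ← congrArg Prod.fst h1,
      (extChartAt I z.1).left_inv hys]
  have hd : MDifferentiableAt (cotangentModel I) I (TotalSpace.proj : CotangentBundle I M → M)
      ((extChartAt (cotangentModel I) z).symm w) :=
    (contMDiff_proj (n := 1) _).mdifferentiableAt one_ne_zero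
  have h2 := (hd.hasMFDerivAt.comp w
    (mdifferentiableAt_extChartAt_symm (cotangentModel I) hwt).hasMFDerivAt).mfderiv
  have h3 := ((mdifferentiableAt_extChartAt_symm I hw1t).hasMFDerivAt.comp w
    (hasFDerivAt_fst (𝕜 := ℝ) (p := w)).hasMFDerivAt).mfderiv
  rw [hproj.mfderiv_eq] at h2
  have h4 : (mfderiv (cotangentModel I) I (TotalSpace.proj : CotangentBundle I M → M)
      ((extChartAt (cotangentModel I) z).symm w) : E × (E →L[ℝ] ℝ) →L[ℝ] E)
      (mfderiv 𝓘(ℝ, E × (E →L[ℝ] ℝ)) (cotangentModel I) (extChartAt (cotangentModel I) z).symm w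
        (localRep (cotangentModel I) z (cotangentLift I v) w : E × (E →L[ℝ] ℝ))) =
      (mfderiv 𝓘(ℝ, E) I (extChartAt I z.1).symm w.1 : E →L[ℝ] E)
        (localRep (cotangentModel I) z (cotangentLift I v) w).1 :=
    congrArg (fun T : E × (E →L[ℝ] ℝ) →L[ℝ] E ↦
      T (localRep (cotangentModel I) z (cotangentLift I v) w)) (h2.symm.trans h3)
  have h5 : (mfderiv 𝓘(ℝ, E) I (extChartAt I z.1).symm w.1 : E →L[ℝ] E)
      (localRep I z.1 v w.1 : E) = v ((extChartAt I z.1).symm w.1) :=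
    mfderiv_extChartAt_symm_localRep I hw1t v
  rw [mfderiv_extChartAt_symm_localRep (cotangentModel I) hwt, localRep_cotangentLift I hv hwt] at h4
  rw [hzw] at h4
  refine h4.trans (h5.trans ?_)
  rw [hw1, extChartAt_to_inv]

theorem thetaPairing_cotangentLift {v : (x : M) → TangentSpace I x}
    (hv : ContMDiff I I.tangent ∞ (fun x ↦ (⟨x, v x⟩ : TangentBundle I M)))
    (z : CotangentBundle I M) : thetaPairing I (cotangentLift I v) z = z.2 (v z.1) :=
  congrArg z.2 (mfderiv_proj_cotangentLift I hv z)

theorem thetaPairing_cotangentLift_eq {v : (x : M) → TangentSpace I x}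
    (hv : ContMDiff I I.tangent ∞ (fun x ↦ (⟨x, v x⟩ : TangentBundle I M)))
    {z₀ z : CotangentBundle I M} (hz : z ∈ (extChartAt (cotangentModel I) z₀).source) :
    thetaPairing I (cotangentLift I v) z = (extChartAt (cotangentModel I) z₀ z).2
      (localRep I z₀.1 v (extChartAt (cotangentModel I) z₀ z).1) := by
  rw [mem_extChartAt_cotangent_source_iff] at hz
  rw [thetaPairing_cotangentLift I hv, extChartAt_cotangent_apply I hz]
  have h := mfderiv_extChartAt_symm_localRep I ((extChartAt I z₀.1).map_source hz) v
  have h' : (v ((extChartAt I z₀.1).symm (extChartAt I z₀.1 z.1)) : E) = v z.1 := by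
    rw [(extChartAt I z₀.1).left_inv hz]
  exact (congrArg (z.2 : E →L[ℝ] ℝ) (h.trans h')).symm

theorem hasDerivWithinAt_thetaPairing_comp {f g : (x : M) → TangentSpace I x}
    (hf : ContMDiff I I.tangent ∞ (fun x ↦ (⟨x, f x⟩ : TangentBundle I M)))
    (hg : ContMDiff I I.tangent ∞ (fun x ↦ (⟨x, g x⟩ : TangentBundle I M)))
    (h : ∀ x, VectorField.mlieBracket I g f x = 0) {γ : ℝ → CotangentBundle I M} {s : Set ℝ}
    (hγ : IsMIntegralCurveOn γ (cotangentLift I f) s) {t : ℝ} (ht : t ∈ s) :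
    HasDerivWithinAt (fun r ↦ thetaPairing I (cotangentLift I g) (γ r)) 0 s t := by
  have := isManifold_one (cotangentModel I) (M := CotangentBundle I M)
  have hsrc := mem_extChartAt_source (I := cotangentModel I) (γ t)
  have htgt := mem_extChartAt_target (I := cotangentModel I) (γ t)
  have h1 := hγ.hasDerivWithinAt (t₀ := t) ht hsrc
  replace h1 := h1.congr_deriv (tangentCoordChange_self hsrc)
  -- In the chart centred at `γ t` the velocity of the curve is the lift itself, hence `liftRep` of
  -- the representative of `f`.
  have h2 := localRep_extChartAt_self (cotangentModel I) (γ t) (cotangentLift I f)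
  rw [localRep_cotangentLift I hf htgt] at h2
  have h3 : HasDerivWithinAt (fun r ↦ extChartAt (cotangentModel I) (γ t) (γ r))
      (liftRep (localRep I (γ t).1 f) (extChartAt (cotangentModel I) (γ t) (γ t))) s t := by
    rw [h2]; exact h1
  have hbase : (extChartAt (cotangentModel I) (γ t) (γ t)).1 ∈ (extChartAt I (γ t).1).target := by
    rw [extChartAt_cotangent_apply I (mem_extChartAt_source (γ t).1)]
    exact mem_extChartAt_target (γ t).1
  refine (hasDerivWithinAt_pairing (W := localRep I (γ t).1 g)
    ((contDiffAt_localRep I hbase hg).differentiableAt (by simp))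
    (lieBracket_localRep_eq_zero I hg hf h hbase) h3).congr_of_eventuallyEq ?_
    (thetaPairing_cotangentLift_eq I hg hsrc)
  filter_upwards [(hγ t ht).1.preimage_mem_nhdsWithin 
    (extChartAt_source_mem_nhds (I := cotangentModel I) (γ t))] with r hr
  exact thetaPairing_cotangentLift_eq I hg hr

end Manifold

end AdjointSystem

theorem mainTheorem11
    {E : Type*} [NormedAddCommGroup E] [NormedSpace ℝ E] [FiniteDimensional ℝ E]
    {H : Type*} [TopologicalSpace H] (I : ModelWithCorners ℝ E H) [I.Boundaryless]
    {M : Type*} [TopologicalSpace M] [T2Space M] [ChartedSpace H M] [IsManifold I ∞ M]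
    (f g : (x : M) → TangentSpace I x)
    (hf : ContMDiff I I.tangent ∞ (fun x ↦ (⟨x, f x⟩ : TangentBundle I M)))
    (hg : ContMDiff I I.tangent ∞ (fun x ↦ (⟨x, g x⟩ : TangentBundle I M)))
    (hgf : ∀ x, VectorField.mlieBracket I g f x = 0) :
    ContMDiff (AdjointSystem.cotangentModel I) (AdjointSystem.cotangentModel I).tangent ∞
        (fun z ↦ (⟨z, AdjointSystem.cotangentLift I g z⟩ :
          TangentBundle (AdjointSystem.cotangentModel I) (AdjointSystem.CotangentBundle I M))) ∧
      (∀ z : AdjointSystem.CotangentBundle I M,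
        VectorField.mlieBracket (AdjointSystem.cotangentModel I)
          (AdjointSystem.cotangentLift I g) (AdjointSystem.cotangentLift I f) z = 0) ∧
      (∀ (γ : ℝ → AdjointSystem.CotangentBundle I M) (s : Set ℝ), s.OrdConnected →
        IsMIntegralCurveOn γ (AdjointSystem.cotangentLift I f) s →
        ∀ t₁ ∈ s, ∀ t₂ ∈ s,
          AdjointSystem.thetaPairing I (AdjointSystem.cotangentLift I g) (γ t₁) =
            AdjointSystem.thetaPairing I (AdjointSystem.cotangentLift I g) (γ t₂)) := by
  have : CompleteSpace E := FiniteDimensional.complete ℝ E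
  refine ⟨AdjointSystem.contMDiff_cotangentLift I hg,
    AdjointSystem.mlieBracket_cotangentLift_eq_zero I hg hf hgf, fun γ s hs hγ t₁ ht₁ t₂ ht₂ ↦ ?_⟩
  -- Derivatives within `s` suffice, so endpoints belonging to the interval need no separate
  -- treatment.
  have h := Convex.norm_image_sub_le_of_norm_hasDerivWithin_le (C := 0)
    (fun t ht ↦ AdjointSystem.hasDerivWithinAt_thetaPairing_comp I hf hg hgf hγ ht)
    (fun _ _ ↦ norm_zero.le) hs.convex ht₂ ht₁
  rwa [zero_mul, norm_le_zero_iff, sub_eq_zero] at h
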